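/- Let $q$ be an indeterminate. Write $[m]_q=[m]=1+q+\cdots+q^{m-1}$, $(a;q)_k=(1-a)(1-aq)\cdots(1-aq^{k-1})$, and let $\Phi_m(q)$ be the $m$-th cyclotomic polynomial. For rational functions $A(q),B(q)$ and a polynomial $P(q)\in\mathbb{Z}[q]$, $A(q)\equiv B(q)\pmod{P(q)}$ means that $P(q)$ divides, in $\mathbb{Z}[q]$, the numerator of $A(q)-B(q)$ written in lowest terms over $\mathbb{Z}[q]$. Let $n>1$ be an odd integer and let $r\geqslant 1$ be an integer. Then, modulo $[n^r]\prod_{j=1}^r\Phi_{n^j}(q)^2$, $$\sum_{k=0}^{(n^r-1)/2} q^{k^2}[6k+1]\frac{(q;q^2)_k^2 (q^2;q^4)_k}{(q^4;q^4)_k^3} \equiv (-q)^{(1-n)/2}[n]\sum_{k=0}^{(n^{r-1}-1)/2} q^{nk^2}[6k+1]_{q^n}\frac{(q^n;q^{2n})_k^2 (q^{2n};q^{4n})_k}{(q^{4n};q^{4n})_k^3}$$ and $$\sum_{k=0}^{n^r-1} q^{k^2}[6k+1]\frac{(q;q^2)_k^2 (q^2;q^4)_k}{(q^4;q^4)_k^3}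 \equiv (-q)^{(1-n)/2}[n]\sum_{k=0}^{n^{r-1}-1} q^{nk^2}[6k+1]_{q^n}\frac{(q^n;q^{2n})_k^2 (q^{2n};q^{4n})_k}{(q^{4n};q^{4n})_k^3}.$$ -/

import Mathlib

open Polynomial

noncomputable section

namespace QDwork

/-- The `q`-integer `[m]_x = 1 + x + ⋯ + x^(m-1)`. -/
def qInt {K : Type*} [Field K] (m : ℕ) (x : K) : K :=
  ∑ i ∈ Finset.range m, x ^ i

/-- The `q`-shifted factorial `(a; x)_k = (1 - a)(1 - a x) ⋯ (1 - a x^(k-1))`. -/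
def qPochhammer {K : Type*} [Field K] (a x : K) (k : ℕ) : K :=
  ∏ i ∈ Finset.range k, (1 - a * x ^ i)

/-- The sum of `x^(k^2) [6k+1]_x (x; x^2)_k^2 (x^2; x^4)_k / (x^4; x^4)_k^3`
over `0 ≤ k ≤ M`. -/
def truncatedSum {K : Type*} [Field K] (x : K) (M : ℕ) : K :=
  ∑ k ∈ Finset.range (M + 1),
    x ^ (k ^ 2) * qInt (6 * k + 1) x *
      ((qPochhammer x (x ^ 2) k ^ 2 * qPochhammer (x ^ 2) (x ^ 4) k) /
        qPochhammer (x ^ 4) (x ^ 4) k ^ 3)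

/-- Congruence of rational functions in `q` modulo a polynomial `P` in `ℤ[q]`: when `A - B` is
written as a fraction in lowest terms over `ℤ[q]`, its numerator is divisible by `P` in `ℤ[q]`. -/
def CongrMod (P : ℤ[X]) (A B : RatFunc ℤ) : Prop :=
  ∃ N D : ℤ[X], D ≠ 0 ∧ IsRelPrime N D ∧
    A - B = algebraMap ℤ[X] (RatFunc ℤ) N / algebraMap ℤ[X] (RatFunc ℤ) D ∧ P ∣ N

/-- The modulus `[n^r] ∏_{j=1}^r Φ_{n^j}(q)^2`. -/
def modulus (n r : ℕ) : ℤ[X] :=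
  (∑ i ∈ Finset.range (n ^ r), (X : ℤ[X]) ^ i) *
    ∏ j ∈ Finset.Icc 1 r, (cyclotomic (n ^ j) ℤ) ^ 2

end QDwork

end

/-!
Fix `1 < d ∣ n^r` and work in the local ring of `ℤ[q]` at `Φ_d`, where `1 - q^d` is a uniformizer.
Deform `(q; q^2)_k^2 / (q^4; q^4)_k^2` to the quotient of `(aq; q^2)_k (q/a; q^2)_k` by
`(aq^4; q^4)_k (q^4/a; q^4)_k`. A contiguous relation between the parameters `a` and `a q^4`
evaluates the deformed sum in closed form at `a = q^(2j+1)`; modulo `1 - q^d`, it shows that the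
half period sum is a multiple of `a^((d-1)/2)`, hence zero, and by periodicity all the truncated
sums vanish modulo `1 - q^d`, whatever `a` is.

Now subtract the right-hand side, deformed in the same way with base `q^n`, and clear denominators.
The closed forms agree at `a = q^(±(2j+1)n)` for `0 ≤ j ≤ M / n`, where `M` is the length of the
left-hand sum, so this difference is divisible, as a polynomial in `a`, by the corresponding linear
factors as well as by `1 - q^d`. At `a = 1` those factors whose exponent is a multiple of `d`
contribute `1 - q^d` each; when `n ∣ d` they exceed by two the power of `1 - q^d` in the cleared
denominators, so that `(1 - q^d)^3` divides the difference of the two sums.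
-/

noncomputable section

namespace QDwork

section Arithmetic

theorem dvd_mul_iff_div_gcd_dvd {d n : ℕ} (hn : 0 < n) (i : ℕ) :
    d ∣ n * i ↔ d / d.gcd n ∣ i := by
  have hg : 0 < d.gcd n := Nat.gcd_pos_of_pos_right d hn
  rw [← (Nat.coprime_div_gcd_div_gcd hg).dvd_mul_left, ← Nat.mul_dvd_mul_iff_left hg (b := d / _),
    ← mul_assoc, Nat.mul_div_cancel' (Nat.gcd_dvd_left d n),
    Nat.mul_div_cancel' (Nat.gcd_dvd_right d n)]

theorem mul_div_gcd_comm (d n : ℕ) : n * (d / d.gcd n) = d * (n / d.gcd n) := by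
  rw [← Nat.mul_div_assoc _ (Nat.gcd_dvd_left d n), ← Nat.mul_div_assoc _ (Nat.gcd_dvd_right d n),
    mul_comm]

theorem odd_div_gcd {d : ℕ} (hodd : Odd d) (n : ℕ) : Odd (d / d.gcd n) :=
  Odd.of_dvd_nat hodd (Nat.div_dvd_of_dvd (Nat.gcd_dvd_left d n))

theorem div_le_card_filter_dvd {d a : ℕ} (hd : 0 < d) (ha : d.Coprime a) (b k : ℕ) :
    k / d ≤ ((Finset.range k).filter fun i => d ∣ a * i + b).card := by
  have : NeZero d := ⟨hd.ne'⟩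
  set c := (-(b * (a : ZMod d)⁻¹)).val with hc
  calc k / d ≤ k.count (· ≡ c [MOD d]) := by
        rw [Nat.count_modEq_card k hd]; exact Nat.le_add_right _ _
    _ = ((Finset.range k).filter (· ≡ c [MOD d])).card := Nat.count_eq_card_filter_range _ _
    _ ≤ _ := Finset.card_le_card <| Finset.monotone_filter_right _ fun i _ hi => by
        have hi : (i : ZMod d) = -(b * (a : ZMod d)⁻¹) := by
          rw [(ZMod.natCast_eq_natCast_iff _ _ _).2 hi, hc, ZMod.natCast_zmod_val]
        rw [← ZMod.natCast_eq_zero_iff, Nat.cast_add, Nat.cast_mul, hi]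
        linear_combination -(b : ZMod d) * ZMod.coe_mul_inv_eq_one a ha.symm

theorem card_filter_dvd_four_mul {d : ℕ} (hodd : Odd d) (k : ℕ) :
    ((Finset.range k).filter fun i => d ∣ 4 * i + 4).card = k / d := by
  rw [← Nat.card_multiples k d]
  congr 1
  refine Finset.filter_congr fun i _ => ?_
  rw [show 4 * i + 4 = 4 * (i + 1) by ring]
  exact (hodd.coprime_two_right.pow_right 2).dvd_mul_left

theorem prod_filter_dvd_succ {α : Type*} [CommMonoid α] (n : ℕ) (f : ℕ → α) (M : ℕ) :
    ∏ i ∈ (Finset.range M).filter (n ∣ · + 1), f i =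
      ∏ i ∈ Finset.range (M / n), f (n * (i + 1) - 1) := by
  induction M with
  | zero => simp
  | succ M ih =>
    rw [Finset.range_add_one, Finset.filter_insert]
    split_ifs with h
    · have hM : n * (M / n + 1) = M + 1 := by rw [← Nat.succ_div_of_dvd h, Nat.mul_div_cancel' h]
      rw [Finset.prod_insert (by simp), ih, Nat.succ_div_of_dvd h, Finset.prod_range_succ, hM,
        mul_comm, Nat.add_sub_cancel]
    · rw [ih, Nat.succ_div_of_not_dvd h]

/-- The lengths `M` at which a sum over `0 ≤ k ≤ M` is truncated, relative to a period `d`: up to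
multiples of `d`, these are `(d - 1) / 2` and `d - 1`. -/
def IsTruncation (d M : ℕ) : Prop := d ∣ 2 * M + 1 ∨ d ∣ M + 1

namespace IsTruncation
variable {d n M : ℕ}

theorem sub_one_div_two (hd : Odd d) : IsTruncation d ((d - 1) / 2) := by
  obtain ⟨l, rfl⟩ := hd
  exact .inl (dvd_of_eq (by omega))

theorem sub_one (hd : 0 < d) : IsTruncation d (d - 1) :=
  .inr (dvd_of_eq (Nat.sub_add_cancel hd).symm)

theorem of_dvd (h : IsTruncation n M) (hd : d ∣ n) : IsTruncation d M :=
  h.imp hd.trans hd.trans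

theorem div (h : IsTruncation (n * d) M) (hn : Odd n) : IsTruncation d (M / n) := by
  have hn0 : 0 < n := hn.pos
  obtain ⟨m, rfl⟩ := hn
  rcases h with ⟨c, hc⟩ | ⟨c, hc⟩
  · left
    obtain ⟨l, hl⟩ : Odd (d * c) := by
      refine Nat.Odd.of_mul_right (m := 2 * m + 1) ?_
      rw [← mul_assoc, ← hc]; exact odd_two_mul_add_one M
    have hM : M = m + (2 * m + 1) * l := by
      have : (2 * m + 1) * (d * c) = (2 * m + 1) * (2 * l + 1) := by rw [hl]
      rw [← mul_assoc, ← hc] at this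
      linarith
    rw [hM, Nat.add_mul_div_left _ _ hn0, Nat.div_eq_of_lt (by omega), zero_add, ← hl]
    exact dvd_mul_right d c
  · right
    rw [← Nat.succ_div_of_dvd (hc ▸ (dvd_mul_right _ d).mul_right c), hc, mul_assoc,
      Nat.mul_div_cancel_left _ hn0]
    exact dvd_mul_right d c

end IsTruncation

end Arithmetic

section Hypergeometric

theorem apply_mul_add_of_periodic {A : Type*} {d : ℕ} {f : ℕ → A} (hf : Function.Periodic f d)
    (l j : ℕ) : f (l * d + j) = f j := by
  simpa [add_comm] using hf.nat_mul l j

variable {A B : Type*} [CommRing A] [CommRing B]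

/-- The sequence `w` starts with `1` and has term ratios `w (k + 1) / w k = α k / β k`; the ratio
is cleared of its denominator, so that `w` is pinned down only where the `β k` are regular. -/
structure IsHypergeom (α β w : ℕ → A) : Prop where
  zero : w 0 = 1
  succ : ∀ k, w (k + 1) * β k = w k * α k

namespace IsHypergeom
variable {α β w α' β' w' : ℕ → A}

theorem map (h : IsHypergeom α β w) (f : A →+* B) : IsHypergeom (f ∘ α) (f ∘ β) (f ∘ w) where
  zero := by simp [h.zero]
  succ k := by simpa using congrArg f (h.succ k)

theorem mul (h : IsHypergeom α β w) (h' : IsHypergeom α' β' w') :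
    IsHypergeom (α * α') (β * β') (w * w') where
  zero := by simp [h.zero, h'.zero]
  succ k := by
    simp only [Pi.mul_apply]
    linear_combination (w' (k + 1) * β' k) * h.succ k + (w k * α k) * h'.succ k

theorem mul_prod (h : IsHypergeom α β w) (k : ℕ) :
    w k * ∏ i ∈ Finset.range k, β i = ∏ i ∈ Finset.range k, α i := by
  induction k with
  | zero => simp [h.zero]
  | succ k ih =>
    rw [Finset.prod_range_succ, Finset.prod_range_succ, ← ih]
    linear_combination (∏ i ∈ Finset.range k, β i) * h.succ k

theorem exists_of_isUnit (hβ : ∀ k, IsUnit (β k)) : ∃ w, IsHypergeom α β w := by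
  refine ⟨fun k => ∏ i ∈ Finset.range k, α i * ↑(hβ i).unit⁻¹, by simp, fun k => ?_⟩
  rw [Finset.prod_range_succ, mul_assoc, mul_assoc, (hβ k).val_inv_mul, mul_one]

end IsHypergeom

/-- A hypergeometric sequence whose term ratios are periodic modulo `d`, and whose denominators
can vanish only at the last place of each period. -/
structure IsPeriodicHypergeom (d : ℕ) (α β w : ℕ → A) : Prop extends IsHypergeom α β w where
  periodic_num : Function.Periodic α d
  periodic_den : Function.Periodic β d
  isUnit_den : ∀ k, ¬ d ∣ k + 1 → IsUnit (β k)

namespace IsPeriodicHypergeom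
variable {d : ℕ} {α β w α' β' w' e : ℕ → A}

theorem mul (h : IsPeriodicHypergeom d α β w) (h' : IsPeriodicHypergeom d α' β' w') :
    IsPeriodicHypergeom d (α * α') (β * β') (w * w') where
  toIsHypergeom := h.toIsHypergeom.mul h'.toIsHypergeom
  periodic_num := h.periodic_num.mul h'.periodic_num
  periodic_den := h.periodic_den.mul h'.periodic_den
  isUnit_den k hk := (h.isUnit_den k hk).mul (h'.isUnit_den k hk)

theorem isUnit_den_of_lt (h : IsPeriodicHypergeom d α β w) {j : ℕ} (hj : j + 1 < d) :
    IsUnit (β j) :=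
  h.isUnit_den j (Nat.not_dvd_of_pos_of_lt j.succ_pos hj)

theorem apply_mul_add (h : IsPeriodicHypergeom d α β w) (l : ℕ) {j : ℕ} (hj : j < d) :
    w (l * d + j) = w (l * d) * w j := by
  induction j with
  | zero => simp [h.zero]
  | succ j ih =>
    apply (h.isUnit_den_of_lt hj).mul_right_cancel
    have hsucc := h.succ (l * d + j)
    rw [apply_mul_add_of_periodic h.periodic_den, apply_mul_add_of_periodic h.periodic_num,
      ih (by omega)] at hsucc
    rw [← add_assoc, hsucc, mul_assoc, mul_assoc, h.succ]

theorem eq_zero_of_lt (h : IsPeriodicHypergeom d α β w) {m j : ℕ} (hm : α m = 0) (hmj : m < j)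
    (hj : j < d) : w j = 0 := by
  induction j, hmj using Nat.le_induction with
  | base => exact (h.isUnit_den_of_lt hj).mul_left_eq_zero.1 (by rw [h.succ, hm, mul_zero])
  | succ j _ ih =>
    exact (h.isUnit_den_of_lt hj).mul_left_eq_zero.1 (by rw [h.succ, ih (by omega), zero_mul])

theorem sum_range_mul_add (h : IsPeriodicHypergeom d α β w) (he : Function.Periodic e d) (l : ℕ)
    {j : ℕ} (hj : j ≤ d) :
    ∑ k ∈ Finset.range (l * d + j), e k * w k =
      (∑ i ∈ Finset.range l, w (i * d)) * ∑ k ∈ Finset.range d, e k * w k +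
        w (l * d) * ∑ k ∈ Finset.range j, e k * w k := by
  have block (l j : ℕ) (hj : j ≤ d) : ∑ k ∈ Finset.range j, e (l * d + k) * w (l * d + k) =
      w (l * d) * ∑ k ∈ Finset.range j, e k * w k := by
    rw [Finset.mul_sum]
    refine Finset.sum_congr rfl fun k hk => ?_
    rw [h.apply_mul_add l ((Finset.mem_range.1 hk).trans_le hj), apply_mul_add_of_periodic he]
    ring
  rw [Finset.sum_range_add, block l j hj]
  congr 1
  induction l with
  | zero => simp
  | succ l ih =>
    rw [Nat.succ_mul, Finset.sum_range_add, ih, block l d le_rfl, Finset.sum_range_succ, add_mul]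

theorem sum_eq_zero {m M : ℕ} (h : IsPeriodicHypergeom (2 * m + 1) α β w)
    (he : Function.Periodic e (2 * m + 1)) (hm : α m = 0)
    (hsum : ∑ k ∈ Finset.range (m + 1), e k * w k = 0) (hM : IsTruncation (2 * m + 1) M) :
    ∑ k ∈ Finset.range (M + 1), e k * w k = 0 := by
  have hperiod : ∑ k ∈ Finset.range (2 * m + 1), e k * w k = 0 := by
    rw [← hsum]
    refine (Finset.sum_subset (Finset.range_mono (by omega)) fun k hk hk' => ?_).symm
    rw [h.eq_zero_of_lt hm (by simpa using hk') (Finset.mem_range.1 hk), mul_zero]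
  obtain ⟨l, hl | hl⟩ : ∃ l, M + 1 = l * (2 * m + 1) + (m + 1) ∨ M + 1 = l * (2 * m + 1) + 0 := by
    rcases hM with ⟨c, hc⟩ | ⟨c, hc⟩
    · obtain ⟨l, rfl⟩ : Odd c := Nat.Odd.of_mul_right (hc ▸ odd_two_mul_add_one M)
      exact ⟨l, .inl (by linarith)⟩
    · exact ⟨c, .inr (by linarith)⟩
  · rw [hl, h.sum_range_mul_add he l (by omega), hperiod, hsum, mul_zero, mul_zero, add_zero]
  · rw [hl, h.sum_range_mul_add he l (by omega), hperiod]
    simp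

end IsPeriodicHypergeom

end Hypergeometric

section Sums
variable {A B : Type*} [CommRing A] [CommRing B]

/-- The weight `q^(k^2) [6k+1]` of the `k`-th term. -/
def weight (q : A) (k : ℕ) : A := q ^ (k ^ 2) * ∑ i ∈ Finset.range (6 * k + 1), q ^ i

/-- The truncated sum `∑_{k ≤ M} q^(k^2) [6k+1] w k`, in an arbitrary commutative ring. -/
def weightedSum (q : A) (w : ℕ → A) (M : ℕ) : A :=
  ∑ k ∈ Finset.range (M + 1), weight q k * w k

/-- `v k` plays the role of the ratio `∏_{i < k} (1 - q^(a i + b)) / (q^4; q^4)_k`, in a ring where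
the denominator need not be invertible. -/
abbrev IsPochhammerRatio (q : A) (a b : ℕ) (v : ℕ → A) : Prop :=
  IsHypergeom (fun k => 1 - q ^ (a * k + b)) (fun k => 1 - q ^ (4 * k + 4)) v

/-- The factor `(1 - a q^(2i+1)) (a - q^(2i+1))` by which a parameter `a` deforms the factor
`(1 - q^(2i+1))^2` of `(q; q^2)_k^2`. -/
def paramNum (q a : A) (i : ℕ) : A := (1 - a * q ^ (2 * i + 1)) * (a - q ^ (2 * i + 1))

/-- The factor `(1 - a q^(4i+4)) (a - q^(4i+4))` by which a parameter `a` deforms the factor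
`(1 - q^(4i+4))^2` of `(q^4; q^4)_k^2`. -/
def paramDen (q a : A) (i : ℕ) : A := (1 - a * q ^ (4 * i + 4)) * (a - q ^ (4 * i + 4))

/-- The truncated sum deformed by a parameter `a`, multiplied by the common denominator
`∏_{i < M} (1 - a q^(4i+4)) (a - q^(4i+4))`, so that it is a polynomial in `a`. The sequence `v`
stands for `(q^2; q^4)_k / (q^4; q^4)_k`. -/
def paramSum (q a : A) (v : ℕ → A) (M : ℕ) : A :=
  ∑ k ∈ Finset.range (M + 1), weight q k * v k *
    ((∏ i ∈ Finset.range k, paramNum q a i) * ∏ i ∈ Finset.Ico k M, paramDen q a i)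

theorem map_weight (f : A →+* B) (q : A) (k : ℕ) : f (weight q k) = weight (f q) k := by
  simp [weight]

theorem map_weightedSum (f : A →+* B) (q : A) (w : ℕ → A) (M : ℕ) :
    f (weightedSum q w M) = weightedSum (f q) (f ∘ w) M := by
  simp [weightedSum, map_weight]

theorem map_paramSum (f : A →+* B) (q a : A) (v : ℕ → A) (M : ℕ) :
    f (paramSum q a v M) = paramSum (f q) (f a) (f ∘ v) M := by
  simp [paramSum, map_weight, paramNum, paramDen]

theorem one_sub_mul_weight (q : A) (k : ℕ) :
    (1 - q) * weight q k = q ^ (k ^ 2) * (1 - q ^ (6 * k + 1)) := by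
  rw [weight, mul_left_comm, mul_neg_geom_sum]

theorem paramSum_succ (q a : A) (v : ℕ → A) (M : ℕ) :
    paramSum q a v (M + 1) = paramSum q a v M * paramDen q a M +
      weight q (M + 1) * v (M + 1) * ∏ i ∈ Finset.range (M + 1), paramNum q a i := by
  rw [paramSum, Finset.sum_range_succ _ (M + 1), Finset.Ico_self, Finset.prod_empty, mul_one,
    paramSum, Finset.sum_mul]
  congr 1
  refine Finset.sum_congr rfl fun k hk => ?_
  rw [Finset.prod_Ico_succ_top (Nat.lt_succ_iff.1 (Finset.mem_range.1 hk))]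
  ring

theorem paramSum_eq_weightedSum_mul_prod {q a : A} {s : ℕ → A}
    (hs : IsHypergeom (paramNum q a) (paramDen q a) s) (v : ℕ → A) (M : ℕ) :
    paramSum q a v M = weightedSum q (s * v) M * ∏ i ∈ Finset.range M, paramDen q a i := by
  rw [paramSum, weightedSum, Finset.sum_mul]
  refine Finset.sum_congr rfl fun k hk => ?_
  rw [← hs.mul_prod, ← Finset.prod_range_mul_prod_Ico _ (Nat.lt_succ_iff.1 (Finset.mem_range.1 hk)),
    Pi.mul_apply]
  ring

theorem IsPochhammerRatio.map {q : A} {a b : ℕ} {v : ℕ → A} (h : IsPochhammerRatio q a b v)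
    (f : A →+* B) : IsPochhammerRatio (f q) a b (f ∘ v) := by
  simpa [IsPochhammerRatio, Function.comp_def] using IsHypergeom.map h f

theorem IsPochhammerRatio.isHypergeom_paramNum_one {q : A} {u : ℕ → A}
    (hu : IsPochhammerRatio q 2 1 u) :
    IsHypergeom (paramNum q 1) (paramDen q 1) (u * u) := by
  convert hu.mul hu using 1 <;> ext k <;> simp [paramNum, paramDen]

theorem natDegree_paramNum_le (q : A) (i : ℕ) : (paramNum (C q) X i).natDegree ≤ 2 := by
  rw [paramNum, ← C_pow]; compute_degree

theorem natDegree_paramDen_le (q : A) (i : ℕ) : (paramDen (C q) X i).natDegree ≤ 2 := by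
  rw [paramDen, ← C_pow]; compute_degree

theorem natDegree_paramSum_le (q : A) (v : ℕ → A) (M : ℕ) :
    (paramSum (C q) X (C ∘ v) M).natDegree ≤ 2 * M := by
  have hprod (s : Finset ℕ) (f : ℕ → A[X]) (hf : ∀ i, (f i).natDegree ≤ 2) :
      (∏ i ∈ s, f i).natDegree ≤ 2 * s.card :=
    (natDegree_prod_le _ _).trans <| by
      simpa [mul_comm] using Finset.sum_le_card_nsmul s _ 2 fun i _ => hf i
  refine natDegree_sum_le_of_forall_le _ _ fun k hk => ?_
  rw [← map_weight, Function.comp_apply, ← C_mul]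
  have hnum := hprod (Finset.range k) _ (natDegree_paramNum_le q)
  have hden := hprod (Finset.Ico k M) _ (natDegree_paramDen_le q)
  rw [Finset.card_range] at hnum
  rw [Nat.card_Ico] at hden
  have hk : k ≤ M := Nat.lt_succ_iff.1 (Finset.mem_range.1 hk)
  exact (natDegree_C_mul_le _ _).trans (natDegree_mul_le.trans (by omega))

end Sums

section Contiguous
variable {A : Type*} [CommRing A]

theorem pow_mul_prod_paramNum (q a : A) (M : ℕ) :
    q ^ (M + 1) * ∏ i ∈ Finset.range (M + 1), paramNum q a i =
      -((∏ i ∈ Finset.range M, (1 - a * q ^ (2 * i + 3))) *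
        ∏ i ∈ Finset.range (M + 2), (a * q - q ^ (2 * i))) := by
  induction M with
  | zero => simp only [Finset.prod_range_succ, Finset.prod_range_zero, paramNum]; ring
  | succ M ih =>
    rw [Finset.prod_range_succ (fun i => paramNum q a i) (M + 1),
      Finset.prod_range_succ (fun i => 1 - a * q ^ (2 * i + 3)) M,
      Finset.prod_range_succ (fun i => a * q - q ^ (2 * i)) (M + 2), paramNum]
    linear_combination (q * ((1 - a * q ^ (2 * (M + 1) + 1)) * (a - q ^ (2 * (M + 1) + 1)))) * ih

theorem prod_paramNum_mul_pow_four (q a : A) (M : ℕ) :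
    ∏ i ∈ Finset.range (M + 1), paramNum q (a * q ^ 4) i =
      -(q ^ (3 * M + 1) * (∏ i ∈ Finset.range (M + 2), (1 - a * q ^ (2 * i + 3))) *
        ∏ i ∈ Finset.range M, (a * q - q ^ (2 * i))) := by
  induction M with
  | zero => simp only [Finset.prod_range_succ, Finset.prod_range_zero, paramNum]; ring
  | succ M ih =>
    rw [Finset.prod_range_succ (fun i => paramNum q (a * q ^ 4) i) (M + 1),
      Finset.prod_range_succ (fun i => 1 - a * q ^ (2 * i + 3)) (M + 2),
      Finset.prod_range_succ (fun i => a * q - q ^ (2 * i)) M, paramNum]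
    linear_combination ((1 - a * q ^ 4 * q ^ (2 * (M + 1) + 1)) *
      (a * q ^ 4 - q ^ (2 * (M + 1) + 1))) * ih

theorem pow_mul_prod_paramNum_add (q a : A) (M : ℕ) :
    q ^ (M + 1) * (q ^ 2 * (a - q ^ (4 * M + 4)) *
          ∏ i ∈ Finset.range (M + 1), paramNum q (a * q ^ 4) i +
        q ^ (4 * M + 4) * (1 - a * q ^ (4 * M + 8)) *
          ∏ i ∈ Finset.range (M + 1), paramNum q a i) =
      -(q ^ (4 * M + 4) *
        ((a - q ^ (4 * M + 4)) * (1 - a * q ^ (2 * M + 3)) * (1 - a * q ^ (2 * M + 5)) +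
          (1 - a * q ^ (4 * M + 8)) * (a * q - q ^ (2 * M)) * (a * q - q ^ (2 * M + 2))) *
        (∏ i ∈ Finset.range M, (1 - a * q ^ (2 * i + 3))) *
        ∏ i ∈ Finset.range M, (a * q - q ^ (2 * i))) := by
  have hnum := pow_mul_prod_paramNum q a M
  have hnum4 := prod_paramNum_mul_pow_four q a M
  rw [Finset.prod_range_succ (fun i => a * q - q ^ (2 * i)) (M + 1),
    Finset.prod_range_succ (fun i => a * q - q ^ (2 * i)) M] at hnum
  rw [Finset.prod_range_succ (fun i => 1 - a * q ^ (2 * i + 3)) (M + 1),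
    Finset.prod_range_succ (fun i => 1 - a * q ^ (2 * i + 3)) M] at hnum4
  rw [hnum4]
  linear_combination q ^ (4 * M + 4) * (1 - a * q ^ (4 * M + 8)) * hnum

theorem paramSum_contiguous {q : A} (hq : IsUnit q) (a : A) {v : ℕ → A}
    (hv : IsPochhammerRatio q 4 2 v) (M : ℕ) :
    (1 - q) * (q ^ 2 * paramSum q (a * q ^ 4) v M * (a - q ^ (4 * M)) +
        q ^ (4 * M) * (1 - a * q ^ (4 * M + 4)) * paramSum q a v M) =
      q ^ (M ^ 2 + 5 * M) * (1 - q ^ (2 * M + 1)) * (1 - q ^ (4 * M + 2)) * v M *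
        (1 + a * q ^ 2) * (∏ i ∈ Finset.range M, (1 - a * q ^ (2 * i + 3))) *
        ∏ i ∈ Finset.range M, (a * q - q ^ (2 * i)) := by
  induction M with
  | zero =>
    simp only [paramSum, weight, hv.zero, Finset.sum_range_succ, Finset.range_zero,
      Finset.sum_empty, Finset.prod_empty, Finset.Ico_self]
    ring
  | succ M ih =>
    have hnum := pow_mul_prod_paramNum_add q a M
    have hweight := one_sub_mul_weight q (M + 1)
    have hratio := hv.succ M
    rw [paramSum_succ, paramSum_succ, paramDen, paramDen,
      Finset.prod_range_succ (fun i => 1 - a * q ^ (2 * i + 3)) M,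
      Finset.prod_range_succ (fun i => a * q - q ^ (2 * i)) M]
    generalize (∏ i ∈ Finset.range M, (1 - a * q ^ (2 * i + 3))) = α at *
    generalize (∏ i ∈ Finset.range M, (a * q - q ^ (2 * i))) = β at *
    apply (hq.pow (M + 1)).mul_left_cancel
    linear_combination
      q ^ (M + 5) * (a - q ^ (4 * M + 4)) * (1 - a * q ^ (4 * M + 8)) * ih
      - q ^ (M ^ 2 + 6 * M + 5) * (a - q ^ (4 * M + 4)) * (1 - a * q ^ (4 * M + 8)) *
        (1 - q ^ (2 * M + 1)) * (1 + a * q ^ 2) * α * β * hratio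
      + (1 - q) * weight q (M + 1) * v (M + 1) * hnum
      - q ^ (4 * M + 4) *
        ((a - q ^ (4 * M + 4)) * (1 - a * q ^ (2 * M + 3)) * (1 - a * q ^ (2 * M + 5)) +
          (1 - a * q ^ (4 * M + 8)) * (a * q - q ^ (2 * M)) * (a * q - q ^ (2 * M + 2))) *
        v (M + 1) * α * β * hweight

end Contiguous

section Evaluation
variable {A : Type*} [CommRing A]

theorem prod_paramDen_mul_pow_four (q a : A) (M : ℕ) :
    (∏ i ∈ Finset.range M, paramDen q (a * q ^ 4) i) * (1 - a * q ^ 4) * (a - q ^ (4 * M)) =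
      q ^ (4 * M) * (1 - a * q ^ (4 * M + 4)) * (a - 1) *
        ∏ i ∈ Finset.range M, paramDen q a i := by
  induction M with
  | zero => simp
  | succ M ih =>
    rw [Finset.prod_range_succ, Finset.prod_range_succ, paramDen, paramDen]
    linear_combination (q ^ 4 * (1 - a * q ^ (4 * M + 8)) * (a - q ^ (4 * M + 4))) * ih

theorem paramSum_eq_prod_paramDen {q a : A} {α β v : ℕ → A} (hv : IsHypergeom α β v)
    (h : paramNum q a 0 = 0) (M : ℕ) :
    paramSum q a v M = ∏ i ∈ Finset.range M, paramDen q a i := by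
  rw [paramSum, Finset.sum_eq_single_of_mem 0 (by simp)]
  · simp [weight, hv.zero]
  · intro k _ hk
    rw [Finset.prod_eq_zero (Finset.mem_range.2 (Nat.pos_of_ne_zero hk)) h]
    ring

variable [IsDomain A]

theorem paramSum_mul_pow_four {q a μ ν : A} (hq : IsUnit q) (hq1 : 1 - q ≠ 0) {v : ℕ → A}
    (hv : IsPochhammerRatio q 4 2 v) {M i : ℕ} (hi : i < M) (hai : a * q = q ^ (2 * i))
    (haM : a ≠ q ^ (4 * M))
    (h : μ * paramSum q a v M = ν * (1 - a) * ∏ i ∈ Finset.range M, paramDen q a i) :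
    μ * q ^ 2 * paramSum q (a * q ^ 4) v M =
      ν * (1 - a * q ^ 4) * ∏ i ∈ Finset.range M, paramDen q (a * q ^ 4) i := by
  have hprod : ∏ i ∈ Finset.range M, (a * q - q ^ (2 * i)) = 0 :=
    Finset.prod_eq_zero (Finset.mem_range.2 hi) (sub_eq_zero.2 hai)
  have hcontig := paramSum_contiguous hq a hv M
  rw [hprod, mul_zero, mul_eq_zero, or_iff_right hq1] at hcontig
  apply mul_right_cancel₀ (sub_ne_zero.2 haM)
  linear_combination μ * hcontig - q ^ (4 * M) * (1 - a * q ^ (4 * M + 4)) * h -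
    ν * prod_paramDen_mul_pow_four q a M

/-- The deformed sum has a closed form at the odd powers `a = q^(2j+1)`: the contiguous relation
loses its inhomogeneous term there, and leads to them from `a = q` and `a = q⁻¹`, where the sum
has a single nonzero term. -/
theorem paramSum_odd_pow {q : A} (hq : IsUnit q) (hinj : Function.Injective fun i : ℕ => q ^ i)
    {v : ℕ → A} (hv : IsPochhammerRatio q 4 2 v) {M j : ℕ} (hj : j ≤ M) :
    (1 - q) * q ^ j * paramSum q (q ^ (2 * j + 1)) v M =
      (-1) ^ j * (1 - q ^ (2 * j + 1)) *
        ∏ i ∈ Finset.range M, paramDen q (q ^ (2 * j + 1)) i := by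
  have hq1 : 1 - q ≠ 0 := sub_ne_zero.2 (by simpa using hinj.ne zero_ne_one)
  induction j using Nat.twoStepInduction with
  | zero => rw [paramSum_eq_prod_paramDen hv (by simp [paramNum])]; simp
  | one =>
    obtain ⟨b, hb⟩ := hq.exists_left_inv
    have hbM : b ≠ q ^ (4 * M) := fun h =>
      hinj.ne (show 0 ≠ 4 * M + 1 by omega) (by simpa [pow_succ, ← h] using hb.symm)
    have hbase : -(1 - b) * paramSum q b v M =
        -1 * (1 - b) * ∏ i ∈ Finset.range M, paramDen q b i := by
      rw [paramSum_eq_prod_paramDen hv (by simp [paramNum, hb])]; ring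
    have hstep := paramSum_mul_pow_four hq hq1 hv (i := 0) hj (by simpa using hb) hbM hbase
    have hb4 : b * q ^ 4 = q ^ (2 * 1 + 1) := by linear_combination q ^ 3 * hb
    rw [hb4] at hstep
    linear_combination hstep - q * paramSum q (q ^ (2 * 1 + 1)) v M * hb
  | more j ih _ =>
    have hstep := paramSum_mul_pow_four hq hq1 hv (i := j + 1) hj (by ring)
      (hinj.ne (show 2 * j + 1 ≠ 4 * M by omega)) (ih (by omega))
    have hpow : q ^ (2 * j + 1) * q ^ 4 = q ^ (2 * (j + 2) + 1) := by ring
    rw [hpow] at hstep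
    linear_combination hstep

end Evaluation

/-- A root of unity of order `d` whose distinct powers differ by units: the notion of a primitive
`d`-th root of unity suited to rings with zero divisors. -/
structure IsPrincipalRoot {A : Type*} [CommRing A] (x : A) (d : ℕ) : Prop where
  pow_eq_one : x ^ d = 1
  isUnit_one_sub : ∀ i, ¬ d ∣ i → IsUnit (1 - x ^ i)

namespace IsPrincipalRoot
variable {A B : Type*} [CommRing A] [CommRing B] {x a : A} {d h M : ℕ} {u v s : ℕ → A}

theorem map (hx : IsPrincipalRoot x d) (f : A →+* B) : IsPrincipalRoot (f x) d where
  pow_eq_one := by rw [← map_pow, hx.pow_eq_one, map_one]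
  isUnit_one_sub i hi := by simpa using (hx.isUnit_one_sub i hi).map f

theorem pow_eq_one_of_dvd (hx : IsPrincipalRoot x d) {i : ℕ} (hi : d ∣ i) : x ^ i = 1 := by
  obtain ⟨c, rfl⟩ := hi
  rw [pow_mul, hx.pow_eq_one, one_pow]

theorem isUnit (hx : IsPrincipalRoot x d) (hd : 0 < d) : IsUnit x :=
  IsUnit.of_pow_eq_one hx.pow_eq_one hd.ne'

theorem isUnit_pow_sub_pow (hx : IsPrincipalRoot x d) (hd : 0 < d) {i j : ℕ}
    (hij : ¬ i ≡ j [MOD d]) : IsUnit (x ^ i - x ^ j) := by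
  wlog hlt : i ≤ j generalizing i j
  · rw [← neg_sub]
    exact (this (fun h => hij h.symm) (le_of_not_ge hlt)).neg
  have hfactor : x ^ i - x ^ j = x ^ i * (1 - x ^ (j - i)) := by
    rw [mul_sub, mul_one, ← pow_add, Nat.add_sub_cancel' hlt]
  rw [hfactor]
  exact ((hx.isUnit hd).pow i).mul <|
    hx.isUnit_one_sub _ fun h => hij ((Nat.modEq_iff_dvd' hlt).2 h)

theorem isUnit_one_sub_four_mul (hx : IsPrincipalRoot x d) (hd : Odd d) {k : ℕ}
    (hk : ¬ d ∣ k + 1) : IsUnit (1 - x ^ (4 * k + 4)) := by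
  refine hx.isUnit_one_sub _ fun h => hk ?_
  exact (hd.coprime_two_right.pow_right 2).dvd_of_dvd_mul_left (by simpa [mul_add] using h)

theorem periodic_pow (hx : IsPrincipalRoot x d) (b c : ℕ) :
    Function.Periodic (fun k => x ^ (b * k + c)) d := fun k => by
  dsimp only
  rw [show b * (k + d) + c = b * k + c + b * d by ring, pow_add _ _ (b * d),
    hx.pow_eq_one_of_dvd (dvd_mul_left d b), mul_one]

theorem periodic_weight (hx : IsPrincipalRoot x d) (hd : 1 < d) :
    Function.Periodic (weight x) d := fun k => by
  have hunit : IsUnit (1 - x) := by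
    simpa using hx.isUnit_one_sub 1 (Nat.not_dvd_of_pos_of_lt one_pos hd)
  have hsq : x ^ (k + d) ^ 2 = x ^ k ^ 2 := by
    rw [show (k + d) ^ 2 = k ^ 2 + d * (2 * k + d) by ring, pow_add,
      hx.pow_eq_one_of_dvd (dvd_mul_right _ _), mul_one]
  apply hunit.mul_left_cancel
  rw [one_sub_mul_weight, one_sub_mul_weight, hsq]
  exact congrArg (fun y => x ^ k ^ 2 * (1 - y)) (hx.periodic_pow 6 1 k)

theorem periodic_paramNum (hx : IsPrincipalRoot x d) (a : A) :
    Function.Periodic (paramNum x a) d := fun k => by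
  have := hx.periodic_pow 2 1 k
  dsimp only at this
  rw [paramNum, this, paramNum]

theorem periodic_paramDen (hx : IsPrincipalRoot x d) (a : A) :
    Function.Periodic (paramDen x a) d := fun k => by
  have := hx.periodic_pow 4 4 k
  dsimp only at this
  rw [paramDen, this, paramDen]

theorem isPeriodicHypergeom (hx : IsPrincipalRoot x d) (hd : Odd d) {b c : ℕ}
    (hv : IsPochhammerRatio x b c v) :
    IsPeriodicHypergeom d (fun k => 1 - x ^ (b * k + c)) (fun k => 1 - x ^ (4 * k + 4)) v where
  toIsHypergeom := hv
  periodic_num k := congrArg (1 - ·) (hx.periodic_pow b c k)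
  periodic_den k := congrArg (1 - ·) (hx.periodic_pow 4 4 k)
  isUnit_den _ hk := hx.isUnit_one_sub_four_mul hd hk

theorem weightedSum_eq_zero_of_paramSum_eq_zero (hx : IsPrincipalRoot x (2 * h + 1)) (hh : 0 < h)
    (hv : IsPochhammerRatio x 4 2 v) (hs : IsHypergeom (paramNum x a) (paramDen x a) s)
    (hden : ∀ k, ¬ 2 * h + 1 ∣ k + 1 → IsUnit (paramDen x a k)) (h0 : paramSum x a v h = 0)
    (hM : IsTruncation (2 * h + 1) M) : weightedSum x (s * v) M = 0 := by
  have hs' : IsPeriodicHypergeom (2 * h + 1) (paramNum x a) (paramDen x a) s :=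
    ⟨hs, hx.periodic_paramNum a, hx.periodic_paramDen a, hden⟩
  have hzero : x ^ (4 * h + 2) = 1 := hx.pow_eq_one_of_dvd ⟨2, by ring⟩
  refine (hs'.mul (hx.isPeriodicHypergeom ⟨h, rfl⟩ hv)).sum_eq_zero
    (hx.periodic_weight (by omega)) (by simp [hzero]) ?_ hM
  have hunit : IsUnit (∏ i ∈ Finset.range h, paramDen x a i) :=
    IsUnit.prod_iff.2 fun i hi =>
      hden i (Nat.not_dvd_of_pos_of_lt i.succ_pos (by have := Finset.mem_range.1 hi; omega))
  exact hunit.mul_left_eq_zero.1 (by rw [← h0, paramSum_eq_weightedSum_mul_prod hs]; rfl)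

theorem paramSum_X_comp (hx : IsPrincipalRoot x (2 * h + 1)) (hh : 0 < h)
    (hv : IsPochhammerRatio x 4 2 v) :
    (paramSum (C x) X (C ∘ v) h).comp (C (x ^ 4) * X) =
      C (x ^ (4 * h)) * paramSum (C x) X (C ∘ v) h := by
  have hCx : IsPrincipalRoot (C x) (2 * h + 1) := hx.map C
  have hunit : IsUnit (1 - C x) := by
    simpa using hCx.isUnit_one_sub 1 (Nat.not_dvd_of_pos_of_lt one_pos (by omega))
  have hcomp := map_paramSum (compRingHom (C (x ^ 4) * X)) (C x) X (C ∘ v) h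
  simp only [coe_compRingHom_apply, X_comp, C_comp, C_pow, Function.comp_def] at hcomp
  have hcontig := paramSum_contiguous (hCx.isUnit (by omega)) X (hv.map C) h
  rw [hCx.pow_eq_one, sub_self, mul_zero, zero_mul, zero_mul, zero_mul, zero_mul, zero_mul,
    hunit.mul_right_eq_zero, pow_add, mul_comm X (C x ^ 4), Function.comp_def,
    ← hcomp] at hcontig
  have hpow : C x ^ (4 * h) * C x ^ 2 = 1 := by
    rw [← pow_add, hCx.pow_eq_one_of_dvd ⟨2, by ring⟩]
  apply (monic_X_sub_C (x ^ (4 * h))).isRegular.right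
  apply ((hCx.isUnit (by omega)).pow 2).mul_left_cancel
  simp only [C_pow, Function.comp_def] at hcontig ⊢
  linear_combination hcontig +
    C x ^ (4 * h) * paramSum (C x) X (fun i => C (v i)) h * (1 + X * C x ^ 2) * hpow

theorem eq_C_mul_X_pow_of_comp_eq (hx : IsPrincipalRoot x (2 * h + 1)) {P : A[X]}
    (hdeg : P.natDegree ≤ 2 * h) (hP : P.comp (C (x ^ 4) * X) = C (x ^ (4 * h)) * P) :
    P = C (P.coeff h) * X ^ h := by
  ext j
  rw [coeff_C_mul_X_pow]
  split_ifs with hj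
  · rw [hj]
  by_cases hjd : 2 * h < j
  · exact coeff_eq_zero_of_natDegree_lt (hdeg.trans_lt hjd)
  have hcoeff : (x ^ (4 * j) - x ^ (4 * h)) * P.coeff j = 0 := by
    have := congrArg (coeff · j) hP
    simp only [comp_C_mul_X_coeff, coeff_C_mul] at this
    rw [sub_mul, ← this, pow_mul, mul_comm, sub_self]
  refine (hx.isUnit_pow_sub_pow (by omega) fun hmod => hj ?_).mul_right_eq_zero.1 hcoeff
  have hcop : Nat.Coprime (2 * h + 1) 4 := (odd_two_mul_add_one h).coprime_two_right.pow_right 2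
  exact (hmod.cancel_left_of_coprime hcop).eq_of_lt_of_lt (by omega) (by omega)

theorem prod_paramDen_self (hx : IsPrincipalRoot x (2 * h + 1)) (hh : 0 < h) :
    ∏ i ∈ Finset.range h, paramDen x x i = 0 := by
  obtain ⟨t, rfl | rfl⟩ := Nat.even_or_odd' h
  · refine Finset.prod_eq_zero (i := t - 1) (Finset.mem_range.2 (by omega)) ?_
    have hpow : x * x ^ (4 * (t - 1) + 4) = 1 := by
      rw [← pow_succ', show 4 * (t - 1) + 4 + 1 = 2 * (2 * t) + 1 by omega, hx.pow_eq_one]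
    rw [paramDen, hpow, sub_self, zero_mul]
  · refine Finset.prod_eq_zero (i := t) (Finset.mem_range.2 (by omega)) ?_
    have hpow : x ^ (4 * t + 4) = x := by
      rw [show 4 * t + 4 = 2 * (2 * t + 1) + 1 + 1 by ring, pow_succ, hx.pow_eq_one, one_mul]
    rw [paramDen, hpow, sub_self, mul_zero]

/-- The quasi-periodicity under `a ↦ a x^4` leaves only the monomial `a^h`, which is excluded by
evaluating at `a = x`. -/
theorem paramSum_X_eq_zero_of_half (hx : IsPrincipalRoot x (2 * h + 1)) (hh : 0 < h)
    (hv : IsPochhammerRatio x 4 2 v) : paramSum (C x) X (C ∘ v) h = 0 := by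
  have hmono := hx.eq_C_mul_X_pow_of_comp_eq (natDegree_paramSum_le x v h)
    (hx.paramSum_X_comp hh hv)
  have heval : (paramSum (C x) X (C ∘ v) h).eval x = 0 := by
    rw [← coe_evalRingHom, map_paramSum, coe_evalRingHom, eval_C, eval_X,
      show eval x ∘ C ∘ v = v by ext; simp, paramSum_eq_prod_paramDen hv (by simp [paramNum]),
      hx.prod_paramDen_self hh]
  rw [hmono, eval_C_mul, eval_pow, eval_X,
    ((hx.isUnit (by omega)).pow h).mul_left_eq_zero] at heval
  rw [hmono, heval, C_0, zero_mul]

theorem weightedSum_eq_zero (hx : IsPrincipalRoot x d) (hd : 1 < d) (hodd : Odd d)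
    (hu : IsPochhammerRatio x 2 1 u) (hv : IsPochhammerRatio x 4 2 v) (hM : IsTruncation d M) :
    weightedSum x (u * u * v) M = 0 := by
  obtain ⟨h, rfl⟩ := hodd
  refine hx.weightedSum_eq_zero_of_paramSum_eq_zero (by omega) hv hu.isHypergeom_paramNum_one
    (fun k hk => ?_) ?_ hM
  · have hunit := hx.isUnit_one_sub_four_mul (odd_two_mul_add_one h) hk
    simpa [paramDen] using hunit
  · have := congrArg (eval 1) (hx.paramSum_X_eq_zero_of_half (by omega) hv)
    rwa [← coe_evalRingHom, map_paramSum, map_zero, coe_evalRingHom, eval_C, eval_X,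
      show eval 1 ∘ C ∘ v = v by ext; simp] at this

theorem isUnit_paramDen_X (hx : IsUnit x) (k : ℕ) :
    IsUnit (paramDen (PowerSeries.C x) (PowerSeries.X : PowerSeries A) k) := by
  rw [PowerSeries.isUnit_iff_constantCoeff]
  simpa [paramDen] using hx.pow (4 * k + 4)

theorem paramSum_X_eq_zero (hx : IsPrincipalRoot x d) (hd : 1 < d) (hodd : Odd d)
    (hv : IsPochhammerRatio x 4 2 v) (hM : IsTruncation d M) :
    paramSum (C x) X (C ∘ v) M = 0 := by
  obtain ⟨h, rfl⟩ := hodd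
  have hcoe (M : ℕ) : ((paramSum (C x) X (C ∘ v) M : A[X]) : PowerSeries A) =
      paramSum (PowerSeries.C x) PowerSeries.X (PowerSeries.C ∘ v) M := by
    rw [← coeToPowerSeries.ringHom_apply, map_paramSum]
    simp [Function.comp_def]
  have hden := isUnit_paramDen_X (hx.isUnit (by omega))
  obtain ⟨s, hs⟩ := IsHypergeom.exists_of_isUnit hden
  apply Polynomial.coe_injective
  rw [hcoe, paramSum_eq_weightedSum_mul_prod hs,
    (hx.map PowerSeries.C).weightedSum_eq_zero_of_paramSum_eq_zero (by omega) (hv.map _) hs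
      (fun k _ => hden k) ?_ hM, zero_mul, coe_zero]
  rw [← hcoe, hx.paramSum_X_eq_zero_of_half (by omega) hv, coe_zero]

end IsPrincipalRoot

theorem one_sub_pow_dvd_one_sub_pow_pow {O : Type*} [CommRing O] (q : O) (d n : ℕ) :
    1 - q ^ d ∣ 1 - (q ^ n) ^ (d / d.gcd n) := by
  rw [← pow_mul, mul_div_gcd_comm, pow_mul]
  exact one_sub_dvd_one_sub_pow _ _

theorem C_dvd_iff_map_eq_zero {O : Type*} [CommRing O] {c : O} {P : O[X]} :
    C c ∣ P ↔ P.map (Ideal.Quotient.mk (Ideal.span {c})) = 0 := by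
  simp [C_dvd_iff_dvd_coeff, Polynomial.ext_iff, Ideal.Quotient.eq_zero_iff_dvd]

/-- `q` behaves like a primitive `d`-th root of unity modulo `1 - q^d`, which is nonzero and
divides each `1 - q^(d j)`, `j > 0`, exactly once. -/
structure IsNearRoot {O : Type*} [CommRing O] (q : O) (d : ℕ) : Prop where
  isUnit : IsUnit q
  isUnit_one_sub : ∀ i, ¬ d ∣ i → IsUnit (1 - q ^ i)
  isUnit_geom : ∀ j, 0 < j → IsUnit (∑ i ∈ Finset.range j, (q ^ d) ^ i)
  ne_zero : 1 - q ^ d ≠ 0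

namespace IsNearRoot
variable {O : Type*} [CommRing O] {q : O} {d n M : ℕ} {u v : ℕ → O}

theorem pos (h : IsNearRoot q d) : 0 < d :=
  Nat.pos_of_ne_zero fun hd => h.ne_zero (by simp [hd])

theorem isPrincipalRoot_mk (h : IsNearRoot q d) :
    IsPrincipalRoot (Ideal.Quotient.mk (Ideal.span {1 - q ^ d}) q) d where
  pow_eq_one := by
    rw [eq_comm, ← sub_eq_zero, ← map_pow, ← map_one (Ideal.Quotient.mk _), ← map_sub]
    exact (Ideal.Quotient.eq_zero_iff_dvd _ _).2 dvd_rfl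
  isUnit_one_sub i hi := by
    rw [← map_pow, ← map_one (Ideal.Quotient.mk _), ← map_sub]
    exact (h.isUnit_one_sub i hi).map _

theorem dvd_weightedSum (h : IsNearRoot q d) (hd : 1 < d) (hodd : Odd d)
    (hu : IsPochhammerRatio q 2 1 u) (hv : IsPochhammerRatio q 4 2 v) (hM : IsTruncation d M) :
    1 - q ^ d ∣ weightedSum q (u * u * v) M := by
  rw [← Ideal.Quotient.eq_zero_iff_dvd, map_weightedSum,
    ← h.isPrincipalRoot_mk.weightedSum_eq_zero hd hodd (hu.map _) (hv.map _) hM]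
  congr 1

theorem C_dvd_paramSum (h : IsNearRoot q d) (hd : 1 < d) (hodd : Odd d)
    (hv : IsPochhammerRatio q 4 2 v) (hM : IsTruncation d M) :
    C (1 - q ^ d) ∣ paramSum (C q) X (C ∘ v) M := by
  rw [C_dvd_iff_map_eq_zero, ← coe_mapRingHom, map_paramSum,
    ← h.isPrincipalRoot_mk.paramSum_X_eq_zero hd hodd (hv.map _) hM]
  simp [Function.comp_def]

theorem associated_one_sub_pow (h : IsNearRoot q d) {i : ℕ} (hi : 0 < i) :
    Associated (1 - q ^ i) (if d ∣ i then 1 - q ^ d else 1) := by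
  split_ifs with hdi
  · obtain ⟨j, rfl⟩ := hdi
    rw [pow_mul, ← mul_neg_geom_sum]
    exact associated_mul_unit_left _ _ (h.isUnit_geom j (Nat.pos_of_mul_pos_left hi))
  · exact associated_one_iff_isUnit.2 (h.isUnit_one_sub i hdi)

theorem associated_prod_one_sub_pow (h : IsNearRoot q d) {ι : Type*} (s : Finset ι) {f : ι → ℕ}
    (hf : ∀ i ∈ s, 0 < f i) :
    Associated (∏ i ∈ s, (1 - q ^ f i)) ((1 - q ^ d) ^ (s.filter fun i => d ∣ f i).card) := by
  rw [← Finset.prod_const, Finset.prod_filter]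
  exact Associated.prod _ _ _ fun i hi => h.associated_one_sub_pow (hf i hi)

variable [IsDomain O]

theorem one_sub_pow_ne_zero (h : IsNearRoot q d) {i : ℕ} (hi : 0 < i) : 1 - q ^ i ≠ 0 := by
  rw [(h.associated_one_sub_pow hi).ne_zero_iff]
  split_ifs
  exacts [h.ne_zero, one_ne_zero]

theorem pow_injective (h : IsNearRoot q d) : Function.Injective fun i : ℕ => q ^ i := by
  intro i j hij
  wlog hle : i ≤ j generalizing i j
  · exact (this hij.symm (le_of_not_ge hle)).symm
  obtain ⟨k, rfl⟩ := Nat.exists_eq_add_of_le hle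
  by_contra hne
  refine h.one_sub_pow_ne_zero (i := k) (by omega) ((h.isUnit.pow i).mul_left_cancel ?_)
  linear_combination hij

theorem pow (h : IsNearRoot q d) (hn : 0 < n) : IsNearRoot (q ^ n) (d / d.gcd n) where
  isUnit := h.isUnit.pow n
  isUnit_one_sub i hi := by
    rw [← pow_mul]
    exact h.isUnit_one_sub _ fun hdvd => hi ((dvd_mul_iff_div_gcd_dvd hn i).1 hdvd)
  isUnit_geom j hj := by
    have hc : 0 < n / d.gcd n := Nat.div_pos (Nat.gcd_le_right d hn) (Nat.gcd_pos_of_pos_right d hn)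
    rw [← pow_mul, mul_div_gcd_comm, pow_mul]
    refine isUnit_of_mul_isUnit_right (x := ∑ i ∈ Finset.range (n / d.gcd n), (q ^ d) ^ i) ?_
    convert h.isUnit_geom _ (Nat.mul_pos hc hj) using 1
    apply mul_left_cancel₀ h.ne_zero
    rw [← mul_assoc, mul_neg_geom_sum, mul_neg_geom_sum, mul_neg_geom_sum, pow_mul]
  ne_zero := by
    rw [← pow_mul]
    exact h.one_sub_pow_ne_zero <| Nat.mul_pos hn <|
      Nat.div_pos (Nat.gcd_le_left n h.pos) (Nat.gcd_pos_of_pos_left n h.pos)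

theorem exists_isPochhammerRatio (h : IsNearRoot q d) (hodd : Odd d) {a b : ℕ}
    (ha : d.Coprime a) (hb : 0 < b) : ∃ v, IsPochhammerRatio q a b v := by
  have hdvd (k : ℕ) : ∏ i ∈ Finset.range k, (1 - q ^ (4 * i + 4)) ∣
      ∏ i ∈ Finset.range k, (1 - q ^ (a * i + b)) := by
    rw [(h.associated_prod_one_sub_pow (Finset.range k) (by simp)).dvd_iff_dvd_left,
      (h.associated_prod_one_sub_pow (Finset.range k) fun i _ =>
        Nat.add_pos_right (a * i) hb).dvd_iff_dvd_right, card_filter_dvd_four_mul hodd]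
    exact pow_dvd_pow _ (div_le_card_filter_dvd h.pos ha b k)
  choose v hv using hdvd
  refine ⟨v, by simpa using (hv 0).symm, fun k => ?_⟩
  have hne : ∏ i ∈ Finset.range k, (1 - q ^ (4 * i + 4)) ≠ 0 :=
    Finset.prod_ne_zero_iff.2 fun i _ => h.one_sub_pow_ne_zero (by omega)
  have hsucc := hv (k + 1)
  rw [Finset.prod_range_succ, Finset.prod_range_succ, hv k] at hsucc
  apply mul_left_cancel₀ hne
  linear_combination -hsucc

end IsNearRoot

section Truncation

/-- The odd multiples `(2j+1)n` with `j ≤ M / n`, the exponents `e` for which the deformed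
difference vanishes at `q^e` and `q^(-e)`. -/
def oddMultiples (n M : ℕ) : Finset ℕ :=
  (Finset.range (M / n + 1)).image fun j => (2 * j + 1) * n

theorem card_oddMultiples {n : ℕ} (hn : 0 < n) (M : ℕ) : (oddMultiples n M).card = M / n + 1 := by
  rw [oddMultiples, Finset.card_image_of_injective, Finset.card_range]
  intro i j hij
  have := Nat.eq_of_mul_eq_mul_right hn hij
  omega

namespace IsTruncation
variable {n g c M j : ℕ}

theorem mul_add_le (h : IsTruncation n M) (hn : n = 2 * c + 1) (hj : j ≤ M / n) :
    j * n + c ≤ M := by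
  have hmod := Nat.div_add_mod M n
  have hjn := Nat.mul_le_mul_right n hj
  rw [mul_comm (M / n)] at hjn
  have hc : c ≤ M % n := by
    rcases h with h | h
    · have hsplit : 2 * M + 1 = n * (2 * (M / n)) + (2 * (M % n) + 1) := by linarith
      rw [hsplit] at h
      have := Nat.le_of_dvd (by omega) ((Nat.dvd_add_right (dvd_mul_right _ _)).1 h)
      omega
    · rw [← hmod, add_assoc] at h
      have := Nat.le_of_dvd (by omega) ((Nat.dvd_add_right (dvd_mul_right _ _)).1 h)
      omega
  omega

theorem oddMultiples_mul_subset (h : IsTruncation g (M / n)) (hg : Odd g) :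
    oddMultiples (n * g) M ⊆ (oddMultiples n M).filter (n * g ∣ ·) := by
  obtain ⟨c, hc⟩ := hg
  intro e he
  obtain ⟨j, hj, rfl⟩ := Finset.mem_image.1 he
  have hj' : j ≤ M / n / g := by
    rw [Nat.div_div_eq_div_mul]; exact Nat.lt_succ_iff.1 (Finset.mem_range.1 hj)
  refine Finset.mem_filter.2 ⟨Finset.mem_image.2 ⟨j * g + c, ?_, ?_⟩, dvd_mul_left _ _⟩
  · exact Finset.mem_range.2 (Nat.lt_succ_iff.2 (h.mul_add_le hc hj'))
  · rw [hc]; ring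

end IsTruncation

end Truncation

section ParamDiff
variable {A B : Type*} [CommRing A] [CommRing B]

/-- The quotient of the common denominator of `paramSum q a v M` by that of
`paramSum (q ^ n) a v (M / n)`. -/
def extraDen (q a : A) (n M : ℕ) : A :=
  ∏ i ∈ (Finset.range M).filter (¬ n ∣ · + 1), paramDen q a i

/-- The difference of the sum with base `q` and `ρ` times the sum with base `q^n`, both deformed by
the parameter `a`, multiplied by their common denominator. -/
def paramDiff (q a ρ : A) (v v' : ℕ → A) (n M : ℕ) : A :=
  paramSum q a v M - ρ * paramSum (q ^ n) a v' (M / n) * extraDen q a n M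

theorem map_paramDiff (f : A →+* B) (q a ρ : A) (v v' : ℕ → A) (n M : ℕ) :
    f (paramDiff q a ρ v v' n M) = paramDiff (f q) (f a) (f ρ) (f ∘ v) (f ∘ v') n M := by
  simp [paramDiff, map_paramSum, extraDen, paramDen]

theorem eval_paramDiff (q a ρ : A) (v v' : ℕ → A) (n M : ℕ) :
    (paramDiff (C q) X (C ρ) (C ∘ v) (C ∘ v') n M).eval a = paramDiff q a ρ v v' n M := by
  rw [← coe_evalRingHom, map_paramDiff]
  simp [Function.comp_def]

theorem prod_paramDen_mul_extraDen (q a : A) (n M : ℕ) :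
    (∏ i ∈ Finset.range (M / n), paramDen (q ^ n) a i) * extraDen q a n M =
      ∏ i ∈ Finset.range M, paramDen q a i := by
  rw [← Finset.prod_filter_mul_prod_filter_not (Finset.range M) (n ∣ · + 1),
    prod_filter_dvd_succ, extraDen]
  congr 1
  refine Finset.prod_congr rfl fun i hi => ?_
  have hn : 0 < n := Nat.pos_of_ne_zero fun hn => by simp [hn] at hi
  have hexp : 4 * (n * (i + 1) - 1) + 4 = n * (4 * i + 4) := by
    have hpos : 0 < n * (i + 1) := by positivity
    rw [show n * (4 * i + 4) = 4 * (n * (i + 1)) by ring]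
    omega
  rw [paramDen, paramDen, hexp, pow_mul]

theorem paramDiff_one {q : A} {n : ℕ} (ρ : A) {u v u' v' : ℕ → A}
    (hu : IsPochhammerRatio q 2 1 u) (hu' : IsPochhammerRatio (q ^ n) 2 1 u') (M : ℕ) :
    paramDiff q 1 ρ v v' n M =
      (weightedSum q (u * u * v) M - ρ * weightedSum (q ^ n) (u' * u' * v') (M / n)) *
        ∏ i ∈ Finset.range M, paramDen q 1 i := by
  rw [paramDiff, paramSum_eq_weightedSum_mul_prod hu.isHypergeom_paramNum_one,
    paramSum_eq_weightedSum_mul_prod hu'.isHypergeom_paramNum_one, sub_mul,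
    ← prod_paramDen_mul_extraDen q 1 n]
  ring

section Inverse
variable {a b : A}

theorem one_sub_mul_mul_sub_mul_sq (hab : a * b = 1) (x : A) :
    (1 - b * x) * (b - x) * a ^ 2 = (1 - a * x) * (a - x) := by
  linear_combination (a + x ^ 2 * a + x * (-1 - a * b)) * hab

theorem prod_paramDen_mul_sq (q : A) (hab : a * b = 1) (s : Finset ℕ) :
    (∏ i ∈ s, paramDen q b i) * (a ^ 2) ^ s.card = ∏ i ∈ s, paramDen q a i := by
  rw [← Finset.prod_const, ← Finset.prod_mul_distrib]
  exact Finset.prod_congr rfl fun i _ => one_sub_mul_mul_sub_mul_sq hab _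

theorem prod_paramNum_mul_sq (q : A) (hab : a * b = 1) (s : Finset ℕ) :
    (∏ i ∈ s, paramNum q b i) * (a ^ 2) ^ s.card = ∏ i ∈ s, paramNum q a i := by
  rw [← Finset.prod_const, ← Finset.prod_mul_distrib]
  exact Finset.prod_congr rfl fun i _ => one_sub_mul_mul_sub_mul_sq hab _

theorem paramSum_mul_sq (q : A) (hab : a * b = 1) (v : ℕ → A) (M : ℕ) :
    paramSum q b v M * (a ^ 2) ^ M = paramSum q a v M := by
  rw [paramSum, Finset.sum_mul]
  refine Finset.sum_congr rfl fun k hk => ?_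
  have hkM : k + (M - k) = M := Nat.add_sub_of_le (Nat.lt_succ_iff.1 (Finset.mem_range.1 hk))
  rw [← prod_paramNum_mul_sq q hab, ← prod_paramDen_mul_sq q hab, Finset.card_range, Nat.card_Ico]
  nth_rw 2 [← hkM]
  ring

theorem paramDiff_mul_sq (q : A) (hab : a * b = 1) (ρ : A) (v v' : ℕ → A) (n M : ℕ) :
    paramDiff q b ρ v v' n M * (a ^ 2) ^ M = paramDiff q a ρ v v' n M := by
  have hcard : M = M / n + ((Finset.range M).filter (¬ n ∣ · + 1)).card := by
    rw [← Nat.card_multiples M n, Finset.card_filter_add_card_filter_not, Finset.card_range]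
  rw [paramDiff, paramDiff, ← paramSum_mul_sq q hab, ← paramSum_mul_sq (q ^ n) hab, extraDen,
    extraDen, ← prod_paramDen_mul_sq q hab, sub_mul]
  congr 1
  nth_rw 3 [hcard]
  rw [pow_add]
  ring

end Inverse

theorem paramDiff_odd_pow [IsDomain A] {q : A} {c n M j : ℕ} (hq : IsUnit q)
    (hinj : Function.Injective fun i : ℕ => q ^ i) (hn : n = 2 * c + 1) {v v' : ℕ → A}
    (hv : IsPochhammerRatio q 4 2 v) (hv' : IsPochhammerRatio (q ^ n) 4 2 v') {ρ : A}
    (hρ : (1 - q) * (q ^ c * ρ) = (-1) ^ c * (1 - q ^ n)) (hj : j ≤ M / n)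
    (hjM : j * n + c ≤ M) :
    paramDiff q (q ^ ((2 * j + 1) * n)) ρ v v' n M = 0 := by
  have hn0 : 0 < n := by omega
  have hinj' : Function.Injective fun i : ℕ => (q ^ n) ^ i := by
    simp only [← pow_mul]
    exact hinj.comp fun i j hij => Nat.eq_of_mul_eq_mul_left hn0 hij
  have hsum := paramSum_odd_pow hq hinj hv hjM
  have hsum' := paramSum_odd_pow (hq.pow n) hinj' hv' hj
  have hprod := prod_paramDen_mul_extraDen q (q ^ ((2 * j + 1) * n)) n M
  have hexp : 2 * (j * n + c) + 1 = (2 * j + 1) * n := by rw [hn]; ring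
  have hsign : (-1 : A) ^ (j * n + c) = (-1) ^ j * (-1) ^ c := by
    rw [pow_add, hn, mul_comm j, pow_mul, Odd.neg_one_pow (odd_two_mul_add_one c)]
  rw [hexp, hsign, pow_add] at hsum
  rw [← pow_mul, mul_comm n, ← pow_mul, mul_comm n] at hsum'
  have hne : (1 - q) * q ^ (j * n + c) ≠ 0 :=
    mul_ne_zero (sub_ne_zero.2 fun h => absurd (@hinj 0 1 (by simpa using h)) zero_ne_one)
      (hq.pow _).ne_zero
  apply mul_left_cancel₀ hne
  rw [mul_zero, paramDiff, pow_add]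
  set a := q ^ ((2 * j + 1) * n)
  linear_combination hsum - q ^ (j * n) * paramSum (q ^ n) a v' (M / n) * extraDen q a n M * hρ
    - (-1) ^ c * extraDen q a n M * hsum' - (-1) ^ j * (-1) ^ c * (1 - a) * hprod

end ParamDiff

section Roots
variable {O : Type*} [CommRing O]

theorem C_dvd_of_monic_mul {c : O} {R S : O[X]} (hR : R.Monic) (h : C c ∣ R * S) : C c ∣ S := by
  rw [C_dvd_iff_map_eq_zero] at h ⊢
  rw [Polynomial.map_mul] at h
  apply (hR.map _).isRegular.left
  simpa only [mul_zero] using h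

theorem prod_X_sub_C_dvd [IsDomain O] {ι : Type*} {s : Finset ι} {t : ι → O}
    (ht : Set.InjOn t s) {P : O[X]} (hP : ∀ i ∈ s, P.eval (t i) = 0) :
    ∏ i ∈ s, (X - C (t i)) ∣ P := by
  rcases eq_or_ne P 0 with rfl | hP0
  · exact dvd_zero _
  have hnodup : (s.val.map t).Nodup := Multiset.Nodup.map_on (fun _ hi _ hj => ht hi hj) s.nodup
  have hdvd := (Multiset.prod_X_sub_C_dvd_iff_le_roots hP0 (s.val.map t)).2
    ((Multiset.le_iff_subset hnodup).2 fun x hx => by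
      obtain ⟨i, hi, rfl⟩ := Multiset.mem_map.1 hx
      exact (mem_roots hP0).2 (hP i hi))
  rwa [Multiset.map_map] at hdvd

theorem mul_prod_sub_dvd_eval [IsDomain O] {ι : Type*} {s : Finset ι} {t : ι → O}
    (ht : Set.InjOn t s) {P : O[X]} (hP : ∀ i ∈ s, P.eval (t i) = 0) {c : O} (hc : C c ∣ P)
    (y : O) : c * ∏ i ∈ s, (y - t i) ∣ P.eval y := by
  obtain ⟨R, rfl⟩ := prod_X_sub_C_dvd ht hP
  obtain ⟨T, rfl⟩ := C_dvd_of_monic_mul (monic_prod_of_monic _ _ fun i _ => monic_X_sub_C _) hc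
  exact ⟨T.eval y, by simp only [eval_mul, eval_prod, eval_sub, eval_X, eval_C]; ring⟩

end Roots

namespace IsNearRoot
variable {O : Type*} [CommRing O] {q : O} {d n c g M : ℕ} {ρ : O} {u v u' v' : ℕ → O}

theorem dvd_of_div_gcd_eq_one (h : IsNearRoot q d) (hd : 1 < d)
    (hρ : (1 - q) * (q ^ c * ρ) = (-1) ^ c * (1 - q ^ n)) (h1 : d / d.gcd n = 1) :
    1 - q ^ d ∣ ρ := by
  have hunit : IsUnit (1 - q) := by
    simpa using h.isUnit_one_sub 1 (Nat.not_dvd_of_pos_of_lt one_pos hd)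
  rw [← (h.isUnit.pow c).dvd_mul_left, ← hunit.dvd_mul_left, hρ]
  simpa [h1] using (one_sub_pow_dvd_one_sub_pow_pow q d n).mul_left ((-1) ^ c)

theorem associated_prod_paramDen_one (h : IsNearRoot q d) (hodd : Odd d) (M : ℕ) :
    Associated (∏ i ∈ Finset.range M, paramDen q 1 i) ((1 - q ^ d) ^ (2 * (M / d))) := by
  have hprod := h.associated_prod_one_sub_pow (Finset.range M) (f := fun i => 4 * i + 4) (by simp)
  rw [card_filter_dvd_four_mul hodd] at hprod
  rw [two_mul, pow_add]
  simpa only [paramDen, one_mul, Finset.prod_mul_distrib] using hprod.mul_mul hprod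

variable [IsDomain O]

theorem dvd_sub_weightedSum (h : IsNearRoot q d) (hodd : Odd d) (hd : 1 < d) (hn : 0 < n)
    (hu : IsPochhammerRatio q 2 1 u) (hv : IsPochhammerRatio q 4 2 v)
    (hu' : IsPochhammerRatio (q ^ n) 2 1 u') (hv' : IsPochhammerRatio (q ^ n) 4 2 v')
    (hρ : (1 - q) * (q ^ c * ρ) = (-1) ^ c * (1 - q ^ n)) (hM : IsTruncation d M)
    (hM' : IsTruncation (d / d.gcd n) (M / n)) :
    1 - q ^ d ∣ weightedSum q (u * u * v) M -
      ρ * weightedSum (q ^ n) (u' * u' * v') (M / n) := by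
  refine dvd_sub (h.dvd_weightedSum hd hodd hu hv hM) ?_
  rcases Nat.eq_or_lt_of_le (h.pow hn).pos with h1 | h1
  · exact (h.dvd_of_div_gcd_eq_one hd hρ h1.symm).mul_right _
  · exact ((one_sub_pow_dvd_one_sub_pow_pow q d n).trans <|
      (h.pow hn).dvd_weightedSum h1 (odd_div_gcd hodd n) hu' hv' hM').mul_left _

theorem C_dvd_paramDiff (h : IsNearRoot q d) (hodd : Odd d) (hd : 1 < d) (hn : 0 < n)
    (hv : IsPochhammerRatio q 4 2 v) (hv' : IsPochhammerRatio (q ^ n) 4 2 v')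
    (hρ : (1 - q) * (q ^ c * ρ) = (-1) ^ c * (1 - q ^ n)) (hM : IsTruncation d M)
    (hM' : IsTruncation (d / d.gcd n) (M / n)) :
    C (1 - q ^ d) ∣ paramDiff (C q) X (C ρ) (C ∘ v) (C ∘ v') n M := by
  refine dvd_sub (h.C_dvd_paramSum hd hodd hv hM) (Dvd.dvd.mul_right ?_ _)
  rw [← C_pow]
  rcases Nat.eq_or_lt_of_le (h.pow hn).pos with h1 | h1
  · exact (map_dvd C (h.dvd_of_div_gcd_eq_one hd hρ h1.symm)).mul_right _
  · exact ((map_dvd C (one_sub_pow_dvd_one_sub_pow_pow q d n)).trans <|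
      (h.pow hn).C_dvd_paramSum h1 (odd_div_gcd hodd n) hv' hM').mul_left _

theorem pow_dvd_eval_one (h : IsNearRoot q d) {P : O[X]} (hC : C (1 - q ^ d) ∣ P) {s : Finset ℕ}
    (hs : ∀ e ∈ s, 0 < e) (hP : ∀ e ∈ s, P.eval (q ^ e) = 0)
    (hP' : ∀ e ∈ s, ∀ b, q ^ e * b = 1 → P.eval b = 0) :
    (1 - q ^ d) ^ (2 * (s.filter (d ∣ ·)).card + 1) ∣ P.eval 1 := by
  obtain ⟨b, hqb⟩ := h.isUnit.exists_right_inv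
  have hpow (e : ℕ) : q ^ e * b ^ e = 1 := by rw [← mul_pow, hqb, one_pow]
  have hb : IsUnit b := IsUnit.of_mul_eq_one_right _ hqb
  have hbinj : Function.Injective fun e : ℕ => b ^ e := fun e f (hef : b ^ e = b ^ f) =>
    h.pow_injective <| (hb.pow e).mul_right_cancel <| by
      beta_reduce
      rw [hpow, hef, hpow]
  have hinj : Set.InjOn (Sum.elim (q ^ ·) (b ^ ·)) (s.disjSum s : Finset (ℕ ⊕ ℕ)) := by
    have hne {e f : ℕ} (he : 0 < e) (hef : q ^ e = b ^ f) : False := by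
      refine h.one_sub_pow_ne_zero (Nat.add_pos_left he f) ?_
      rw [add_comm, pow_add, hef, hpow, sub_self]
    rintro (e | e) he (f | f) hf hef
    · exact congrArg _ (h.pow_injective hef)
    · exact (hne (hs e (by simpa using he)) hef).elim
    · exact (hne (hs f (by simpa using hf)) hef.symm).elim
    · exact congrArg _ (hbinj hef)
  have hroot : ∀ i ∈ s.disjSum s, P.eval (Sum.elim (q ^ ·) (b ^ ·) i) = 0 := by
    rintro (e | e) he
    · exact hP e (by simpa using he)
    · exact hP' e (by simpa using he) _ (hpow e)
  have hassoc : Associated (∏ e ∈ s, (1 - b ^ e)) (∏ e ∈ s, (1 - q ^ e)) :=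
    Associated.prod _ _ _ fun e _ => by
      rw [show 1 - b ^ e = (1 - q ^ e) * -b ^ e by linear_combination -hpow e]
      exact associated_mul_unit_left _ _ (hb.pow e).neg
  have hprod := h.associated_prod_one_sub_pow s (f := fun e => e) hs
  have hdvd := mul_prod_sub_dvd_eval hinj hroot hC 1
  rw [Finset.prod_disjSum] at hdvd
  rw [two_mul, pow_succ', pow_add]
  exact (((hprod.mul_mul (hassoc.trans hprod)).mul_left _).symm.dvd).trans hdvd

theorem pow_three_dvd_sub_weightedSum (h : IsNearRoot q (n * g)) (hodd : Odd (n * g))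
    (hd : 1 < n * g) (hn : n = 2 * c + 1)
    (hu : IsPochhammerRatio q 2 1 u) (hv : IsPochhammerRatio q 4 2 v)
    (hu' : IsPochhammerRatio (q ^ n) 2 1 u') (hv' : IsPochhammerRatio (q ^ n) 4 2 v')
    (hρ : (1 - q) * (q ^ c * ρ) = (-1) ^ c * (1 - q ^ n)) (hM : IsTruncation (n * g) M) :
    (1 - q ^ (n * g)) ^ 3 ∣ weightedSum q (u * u * v) M -
      ρ * weightedSum (q ^ n) (u' * u' * v') (M / n) := by
  have hM' : IsTruncation g (M / n) := hM.div (Nat.odd_mul.1 hodd).1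
  have hMn : IsTruncation n M := hM.of_dvd (dvd_mul_right n g)
  have hn0 : 0 < n := by omega
  have hroot (e) (he : e ∈ oddMultiples n M) : paramDiff q (q ^ e) ρ v v' n M = 0 := by
    obtain ⟨j, hj, rfl⟩ := Finset.mem_image.1 he
    have hj : j ≤ M / n := Nat.lt_succ_iff.1 (Finset.mem_range.1 hj)
    exact paramDiff_odd_pow h.isUnit h.pow_injective hn hv hv' hρ hj (hMn.mul_add_le hn hj)
  have hcard : M / (n * g) + 1 ≤ ((oddMultiples n M).filter (n * g ∣ ·)).card := by
    rw [← card_oddMultiples h.pos]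
    exact Finset.card_le_card (hM'.oddMultiples_mul_subset (Nat.odd_mul.1 hodd).2)
  have hdvd := h.pow_dvd_eval_one (h.C_dvd_paramDiff hodd hd hn0 hv hv' hρ hM
    (by rwa [Nat.gcd_mul_right_left, Nat.mul_div_cancel_left _ hn0]))
    (s := oddMultiples n M) ?_ ?_ ?_
  · rw [eval_paramDiff, paramDiff_one ρ hu hu',
      ((h.associated_prod_paramDen_one hodd M).mul_left _).dvd_iff_dvd_right,
      mul_comm (_ - _)] at hdvd
    rw [← mul_dvd_mul_iff_left (pow_ne_zero (2 * (M / (n * g))) h.ne_zero),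
      ← pow_add]
    refine (pow_dvd_pow _ ?_).trans hdvd
    omega
  · intro e he
    obtain ⟨j, -, rfl⟩ := Finset.mem_image.1 he
    positivity
  · exact fun e he => (eval_paramDiff ..).trans (hroot e he)
  · intro e he b hb
    have hunit : IsUnit (((q ^ e) ^ 2) ^ M) := ((h.isUnit.pow e).pow 2).pow M
    rw [eval_paramDiff, ← hunit.mul_left_eq_zero, paramDiff_mul_sq q hb, hroot e he]

end IsNearRoot

section FractionField
variable {K : Type*} [Field K] {x : K} {u v : ℕ → K}

theorem qPochhammer_eq_mul {a b : ℕ} (hv : IsPochhammerRatio x a b v) (k : ℕ) :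
    qPochhammer (x ^ b) (x ^ a) k = v k * qPochhammer (x ^ 4) (x ^ 4) k := by
  have hexp (a b i : ℕ) : x ^ b * (x ^ a) ^ i = x ^ (a * i + b) := by ring
  simp only [qPochhammer, hexp]
  exact (hv.mul_prod k).symm

theorem truncatedSum_eq_weightedSum (hx : ∀ i, 0 < i → 1 - x ^ i ≠ 0)
    (hu : IsPochhammerRatio x 2 1 u) (hv : IsPochhammerRatio x 4 2 v) (M : ℕ) :
    truncatedSum x M = weightedSum x (u * u * v) M := by
  refine Finset.sum_congr rfl fun k _ => ?_
  have hden : qPochhammer (x ^ 4) (x ^ 4) k ≠ 0 := Finset.prod_ne_zero_iff.2 fun i _ => by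
    rw [← pow_succ' (x ^ 4), ← pow_mul]
    exact hx _ (by omega)
  have hnum := qPochhammer_eq_mul hu k
  rw [pow_one] at hnum
  rw [hnum, qPochhammer_eq_mul hv, weight, qInt, Pi.mul_apply, Pi.mul_apply]
  field_simp

variable {O : Type*} [CommRing O] {φ : O →+* K} {q : O} {d n N M : ℕ}

theorem exists_map_eq_neg_zpow_mul_qInt (φ : O →+* K) (hq : IsUnit q) {c : ℕ}
    (hn : n = 2 * c + 1) : ∃ ρ, (1 - q) * (q ^ c * ρ) = (-1) ^ c * (1 - q ^ n) ∧
      φ ρ = (-φ q) ^ ((1 - (n : ℤ)) / 2) * qInt n (φ q) := by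
  obtain ⟨b, hqb⟩ := hq.exists_right_inv
  have hpow : q ^ c * (-b) ^ c = (-1) ^ c := by rw [← mul_pow, mul_neg, hqb]
  have hb : φ b = (φ q)⁻¹ := eq_inv_of_mul_eq_one_right (by rw [← map_mul, hqb, map_one])
  have hexp : (1 - (n : ℤ)) / 2 = -(c : ℤ) := by omega
  refine ⟨(-b) ^ c * ∑ i ∈ Finset.range n, q ^ i, ?_, ?_⟩
  · rw [← mul_neg_geom_sum]
    linear_combination ((1 - q) * ∑ i ∈ Finset.range n, q ^ i) * hpow
  · rw [hexp, zpow_neg, zpow_natCast, ← inv_pow, inv_neg, ← hb, qInt]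
    simp only [map_mul, map_pow, map_neg, map_sum]

variable [IsDomain O]

theorem IsNearRoot.truncatedSum_map (h : IsNearRoot q d) (hφ : Function.Injective φ) {u v : ℕ → O}
    (hu : IsPochhammerRatio q 2 1 u) (hv : IsPochhammerRatio q 4 2 v) (M : ℕ) :
    truncatedSum (φ q) M = φ (weightedSum q (u * u * v) M) := by
  rw [map_weightedSum, truncatedSum_eq_weightedSum _ (hu.map φ) (hv.map φ)]
  · congr 1
    ext k
    simp
  · intro i hi
    rw [← map_pow, ← map_one φ, ← map_sub, map_ne_zero_iff φ hφ]
    exact h.one_sub_pow_ne_zero hi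

theorem IsNearRoot.exists_map_eq_sub (h : IsNearRoot q d) (hφ : Function.Injective φ) (hd : 1 < d)
    (hodd : Odd N) (hdN : d ∣ N) (hnN : n ∣ N) (hM : IsTruncation N M) :
    ∃ s : O, φ s = truncatedSum (φ q) M -
        (-φ q) ^ ((1 - (n : ℤ)) / 2) * qInt n (φ q) * truncatedSum (φ q ^ n) (M / n) ∧
      (1 - q ^ d) ^ (if n ∣ d then 3 else 1) ∣ s := by
  have hdodd := hodd.of_dvd_nat hdN
  have hnodd := hodd.of_dvd_nat hnN
  have h' := h.pow hnodd.pos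
  have hd'odd := odd_div_gcd hdodd n
  obtain ⟨c, hc⟩ := hnodd
  obtain ⟨u, hu⟩ := h.exists_isPochhammerRatio hdodd hdodd.coprime_two_right one_pos
  obtain ⟨v, hv⟩ := h.exists_isPochhammerRatio (a := 4) hdodd
    (hdodd.coprime_two_right.pow_right 2) two_pos
  obtain ⟨u', hu'⟩ := h'.exists_isPochhammerRatio hd'odd hd'odd.coprime_two_right one_pos
  obtain ⟨v', hv'⟩ := h'.exists_isPochhammerRatio (a := 4) hd'odd
    (hd'odd.coprime_two_right.pow_right 2) two_pos
  obtain ⟨ρ, hρ, hφρ⟩ := exists_map_eq_neg_zpow_mul_qInt φ h.isUnit hc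
  refine ⟨weightedSum q (u * u * v) M - ρ * weightedSum (q ^ n) (u' * u' * v') (M / n), ?_, ?_⟩
  · rw [h.truncatedSum_map hφ hu hv, ← map_pow, h'.truncatedSum_map hφ hu' hv', map_sub, map_mul,
      hφρ]
  · split_ifs with hnd
    · obtain ⟨g, rfl⟩ := hnd
      exact h.pow_three_dvd_sub_weightedSum hdodd hd hc hu hv hu' hv' hρ (hM.of_dvd hdN)
    · obtain ⟨L, rfl⟩ := hnN
      rw [pow_one]
      exact h.dvd_sub_weightedSum hdodd hd (by omega) hu hv hu' hv' hρ (hM.of_dvd hdN)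
        ((hM.div ⟨c, hc⟩).of_dvd ((dvd_mul_iff_div_gcd_dvd (by omega) L).1 hdN))

end FractionField

section Cyclotomic
variable {d n N : ℕ}

theorem cyclotomic_dvd_iff_aeval_eq_zero {ζ : ℂ} (hd : 0 < d) (hζ : IsPrimitiveRoot ζ d)
    (P : ℤ[X]) : cyclotomic d ℤ ∣ P ↔ aeval ζ P = 0 := by
  rw [cyclotomic_eq_minpoly hζ hd, minpoly.isIntegrallyClosed_dvd_iff (hζ.isIntegral hd)]

theorem isPrime_span_cyclotomic (hd : 0 < d) : (Ideal.span {cyclotomic d ℤ}).IsPrime :=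
  (Ideal.span_singleton_prime (cyclotomic_ne_zero d ℤ)).2 (cyclotomic.irreducible hd).prime

section Localization
variable [(Ideal.span {cyclotomic d ℤ}).IsPrime] {O : Type*} [CommRing O] [Algebra ℤ[X] O]
  [IsLocalization.AtPrime O (Ideal.span {cyclotomic d ℤ})]

theorem isNearRoot_algebraMap_X (hd : 0 < d) : IsNearRoot (algebraMap ℤ[X] O X) d := by
  have hζ := Complex.isPrimitiveRoot_exp d hd.ne'
  set ζ := Complex.exp (2 * Real.pi * Complex.I / d)
  have hunit {P : ℤ[X]} (hP : aeval ζ P ≠ 0) : IsUnit (algebraMap ℤ[X] O P) := by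
    rwa [IsLocalization.AtPrime.isUnit_to_map_iff O (Ideal.span {cyclotomic d ℤ}),
      Ideal.mem_primeCompl_iff, Ideal.mem_span_singleton, cyclotomic_dvd_iff_aeval_eq_zero hd hζ]
  have hinj : Function.Injective (algebraMap ℤ[X] O) :=
    IsLocalization.injective O
      (Ideal.primeCompl_le_nonZeroDivisors (Ideal.span {cyclotomic d ℤ}))
  refine ⟨hunit ?_, fun i hi => ?_, fun j hj => ?_, ?_⟩
  · simpa using hζ.ne_zero hd.ne'
  · have haeval : aeval ζ (1 - X ^ i : ℤ[X]) ≠ 0 := by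
      simpa [sub_eq_zero, eq_comm (a := (1 : ℂ))] using mt (hζ.dvd_of_pow_eq_one i) hi
    simpa using hunit haeval
  · have haeval : aeval ζ (∑ i ∈ Finset.range j, (X ^ d) ^ i : ℤ[X]) ≠ 0 := by
      simpa [hζ.pow_eq_one] using hj.ne'
    simpa using hunit haeval
  · rw [← map_pow, ← map_one (algebraMap ℤ[X] O), ← map_sub, map_ne_zero_iff _ hinj]
    exact fun h => by simpa [hd.ne'] using congrArg (eval 0) h

theorem cyclotomic_pow_dvd_num (hd : 0 < d) {K : Type*} [Field K] [Algebra ℤ[X] K]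
    [IsFractionRing ℤ[X] K] [Algebra O K] [IsScalarTower ℤ[X] O K] {A B : ℤ[X]} (hB : B ≠ 0)
    {s : O} {e : ℕ} (hs : (1 - algebraMap ℤ[X] O X ^ d) ^ e ∣ s)
    (hAB : algebraMap O K s = algebraMap ℤ[X] K A / algebraMap ℤ[X] K B) :
    cyclotomic d ℤ ^ e ∣ A := by
  obtain ⟨t, rfl⟩ := hs
  obtain ⟨⟨P, Q⟩, hPQ⟩ := IsLocalization.surj (Ideal.span {cyclotomic d ℤ}).primeCompl t
  have hQ : ¬ cyclotomic d ℤ ∣ Q := fun h => Q.2 (Ideal.mem_span_singleton.2 h)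
  have hB' : algebraMap ℤ[X] K B ≠ 0 :=
    (map_ne_zero_iff _ (IsFractionRing.injective ℤ[X] K)).2 hB
  have hmul : A * (Q : ℤ[X]) = (1 - X ^ d) ^ e * (P * B) := by
    apply IsFractionRing.injective ℤ[X] K
    have hPQ' := congrArg (algebraMap O K) hPQ
    rw [eq_div_iff hB'] at hAB
    simp only [map_mul, map_pow, map_sub, map_one, ← IsScalarTower.algebraMap_apply] at hPQ' hAB ⊢
    rw [← hAB, ← hPQ']
    ring
  refine (cyclotomic.irreducible hd).prime.pow_dvd_of_dvd_mul_right e hQ (hmul ▸ ?_)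
  rw [← neg_sub (X ^ d)]
  exact (pow_dvd_pow_of_dvd ((cyclotomic.dvd_X_pow_sub_one d ℤ).neg_right) e).mul_right _

end Localization

/-- The polynomial `[N] ∏ Φ_d(q)^2`, the product being over the multiples `d` of `n` that
divide `N`. -/
def multipleModulus (n N : ℕ) : ℤ[X] :=
  (∑ i ∈ Finset.range N, X ^ i) * ∏ d ∈ N.divisors.filter (n ∣ ·), cyclotomic d ℤ ^ 2

theorem isRelPrime_cyclotomic {m n : ℕ} (hm : 0 < m) (hn : 0 < n) (hmn : m ≠ n) :
    IsRelPrime (cyclotomic m ℤ) (cyclotomic n ℤ) := by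
  rw [(cyclotomic.irreducible hm).isRelPrime_iff_not_dvd]
  exact fun hdvd => hmn <| cyclotomic_injective <| eq_of_monic_of_associated
    (cyclotomic.monic m ℤ) (cyclotomic.monic n ℤ)
    ((cyclotomic.irreducible hm).associated_of_dvd (cyclotomic.irreducible hn) hdvd)

theorem multipleModulus_eq_prod (hn : n ≠ 1) (hN : 0 < N) : multipleModulus n N =
    ∏ d ∈ N.divisors.erase 1, cyclotomic d ℤ ^ (if n ∣ d then 3 else 1) := by
  have hfilter : N.divisors.filter (n ∣ ·) = (N.divisors.erase 1).filter (n ∣ ·) := by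
    rw [Finset.filter_erase, Finset.erase_eq_of_notMem]
    simp [hn]
  rw [multipleModulus, ← prod_cyclotomic_eq_geom_sum hN, hfilter, Finset.prod_filter,
    ← Finset.prod_mul_distrib]
  refine Finset.prod_congr rfl fun d _ => ?_
  split_ifs <;> ring

theorem multipleModulus_dvd (hn : n ≠ 1) (hN : 0 < N) {P : ℤ[X]}
    (hP : ∀ d, 1 < d → d ∣ N → cyclotomic d ℤ ^ (if n ∣ d then 3 else 1) ∣ P) :
    multipleModulus n N ∣ P := by
  have hone_lt {d : ℕ} (hd : d ∈ N.divisors.erase 1) : 1 < d := by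
    have := Nat.pos_of_mem_divisors (Finset.mem_of_mem_erase hd)
    have := Finset.ne_of_mem_erase hd
    omega
  rw [multipleModulus_eq_prod hn hN]
  refine Finset.prod_dvd_of_isRelPrime (fun a ha b hb hab => ?_) fun d hd => ?_
  · exact (isRelPrime_cyclotomic (zero_lt_one.trans (hone_lt ha))
      (zero_lt_one.trans (hone_lt hb)) hab).pow
  · exact hP d (hone_lt hd) (Nat.dvd_of_mem_divisors (Finset.mem_of_mem_erase hd))

theorem modulus_dvd_multipleModulus (hn : 1 < n) (r : ℕ) :
    modulus n r ∣ multipleModulus n (n ^ r) := by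
  refine mul_dvd_mul_left _ ?_
  rw [← Finset.prod_image (s := Finset.Icc 1 r) (g := (n ^ ·)) (f := fun d => cyclotomic d ℤ ^ 2)
    (Nat.pow_right_injective hn).injOn]
  refine Finset.prod_dvd_prod_of_subset _ _ _ fun d hd => ?_
  obtain ⟨j, hj, rfl⟩ := Finset.mem_image.1 hd
  obtain ⟨hj1, hjr⟩ := Finset.mem_Icc.1 hj
  exact Finset.mem_filter.2 ⟨Nat.mem_divisors.2 ⟨pow_dvd_pow n hjr, by positivity⟩,
    dvd_pow_self n (by omega)⟩

theorem CongrMod.of_dvd {P Q : ℤ[X]} {A B : RatFunc ℤ} (h : CongrMod P A B) (hQP : Q ∣ P) :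
    CongrMod Q A B := by
  obtain ⟨N, D, hD, hND, hAB, hP⟩ := h
  exact ⟨N, D, hD, hND, hAB, hQP.trans hP⟩

theorem congrMod_of_forall_dvd_num {P : ℤ[X]} {A B : RatFunc ℤ}
    (h : ∀ N D : ℤ[X], D ≠ 0 →
      A - B = algebraMap ℤ[X] (RatFunc ℤ) N / algebraMap ℤ[X] (RatFunc ℤ) D → P ∣ N) :
    CongrMod P A B := by
  obtain ⟨N, D, hND, hAB⟩ := IsFractionRing.exists_reduced_fraction ℤ[X] (A - B)
  rw [IsFractionRing.mk'_eq_div] at hAB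
  have hD := nonZeroDivisors.ne_zero D.2
  exact ⟨N, D, hD, hND, hAB.symm, h N D hD hAB.symm⟩

theorem pow_sub_one_div (hn : 0 < n) {r : ℕ} (hr : 1 ≤ r) :
    (n ^ r - 1) / n = n ^ (r - 1) - 1 := by
  obtain ⟨s, rfl⟩ := Nat.exists_eq_add_of_le' hr
  simpa [pow_succ'] using Nat.mul_sub_div 0 n (n ^ s) (by positivity)

end Cyclotomic

end QDwork

end

theorem theorem2_general (n N M : ℕ) (hn : 1 < n) (hodd : Odd N) (hnN : n ∣ N)
    (hM : N ∣ 2 * M + 1 ∨ N ∣ M + 1) :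
    QDwork.CongrMod (QDwork.multipleModulus n N)
      (QDwork.truncatedSum (RatFunc.X : RatFunc ℤ) M)
      ((-(RatFunc.X : RatFunc ℤ)) ^ ((1 - (n : ℤ)) / 2) * QDwork.qInt n (RatFunc.X : RatFunc ℤ) *
        QDwork.truncatedSum ((RatFunc.X : RatFunc ℤ) ^ n) (M / n)) := by
  refine QDwork.congrMod_of_forall_dvd_num fun A B hB hAB => ?_
  refine QDwork.multipleModulus_dvd hn.ne' hodd.pos fun d hd hdN => ?_
  have hd0 : 0 < d := zero_lt_one.trans hd
  have := QDwork.isPrime_span_cyclotomic hd0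
  let O := Localization.subalgebra.ofField (RatFunc ℤ)
    (Ideal.span {cyclotomic d ℤ}).primeCompl (Ideal.primeCompl_le_nonZeroDivisors _)
  have hq : QDwork.IsNearRoot (algebraMap ℤ[X] O X) d := QDwork.isNearRoot_algebraMap_X hd0
  obtain ⟨s, hs, hdvd⟩ := hq.exists_map_eq_sub (φ := algebraMap O (RatFunc ℤ))
    (FaithfulSMul.algebraMap_injective _ _) hd hodd hdN hnN hM
  rw [← IsScalarTower.algebraMap_apply, RatFunc.algebraMap_X, hAB] at hs
  exact QDwork.cyclotomic_pow_dvd_num hd0 hB hdvd hs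

theorem theorem2 (n r : ℕ) (hn : 1 < n) (hodd : Odd n) (hr : 1 ≤ r) :
    QDwork.CongrMod (QDwork.modulus n r)
      (QDwork.truncatedSum (RatFunc.X : RatFunc ℤ) ((n ^ r - 1) / 2))
      ((-(RatFunc.X : RatFunc ℤ)) ^ ((1 - (n : ℤ)) / 2) * QDwork.qInt n (RatFunc.X : RatFunc ℤ) *
        QDwork.truncatedSum ((RatFunc.X : RatFunc ℤ) ^ n) ((n ^ (r - 1) - 1) / 2)) ∧
    QDwork.CongrMod (QDwork.modulus n r)
      (QDwork.truncatedSum (RatFunc.X : RatFunc ℤ) (n ^ r - 1))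
      ((-(RatFunc.X : RatFunc ℤ)) ^ ((1 - (n : ℤ)) / 2) * QDwork.qInt n (RatFunc.X : RatFunc ℤ) *
        QDwork.truncatedSum ((RatFunc.X : RatFunc ℤ) ^ n) (n ^ (r - 1) - 1)) := by
  have hcongr {M : ℕ} (hM : QDwork.IsTruncation (n ^ r) M) :=
    (theorem2_general n (n ^ r) M hn hodd.pow (dvd_pow_self n (by omega)) hM).of_dvd
      (QDwork.modulus_dvd_multipleModulus hn r)
  rw [← QDwork.pow_sub_one_div hodd.pos hr, Nat.div_right_comm]
  exact ⟨hcongr (.sub_one_div_two hodd.pow), hcongr (.sub_one hodd.pow.pos)⟩
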